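/- **Setting.** Let $v,b\ge 1$ and $k\ge 2$ be integers. A *design* $d$ is a $k\times b$ array with entries $d(p,j)\in\{1,\dots,v\}$ ($d(p,j)$ is the treatment on unit $p$ of block $j$). Put $\phi(p)=\sqrt{3/(k(k^2-1))}\,(2p-k-1)$ and $\phi=(\phi(1),\dots,\phi(k))'$. Let $\sigma_{0\varepsilon}^2>0$, $0\le\lambda_0\le 1/k$, $0\le\lambda_1\le1$. For a design $d$ let $X_{dj}$ be the $k\times v$ matrix with $X_{dj}(p,i)=1$ if $d(p,j)=i$ and $0$ otherwise, $r_d$ the vector of the numbers of occurrences of the treatments in $d$, $M_d$ the $v\times k$ matrix whose entry $(i,p)$ is the number of occurrences of treatment $i$ in row $p$, and $W=I_k-\lambda_0 1_k1_k'-\lambda_1\phi\phi'$. The minimal information matrix $C_d^L$ is defined by $$\sigma_{0\varepsilon}^2C_d^L=\sum_{j=1}^bX_{dj}'WX_{dj}-\frac{1-k\lambda_0}{bk}\,r_dr_d'-\frac{1-\lambda_1}{b}\,M_d\phi\phi'M_d'.$$ A design is *maximin universally optimal* if $C_d^L$ is completely symmetric (of the form $xI+yJ$, with $J$ the all-ones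 matrix) and has maximal trace among all $k\times b$ designs in $v$ treatments. A $t\times b$ array on $v$ symbols is *semibalanced* (an orthogonal array of type II of strength 2) if each column has distinct symbols and, in any two rows, all unordered pairs of distinct symbols occur equally often as columns. **Orders.** An order is a sequence $\pi=(\pi(1),\dots,\pi(k))$ in $\{1,\dots,v\}$. Let $n_i$ be the number of positions of $i$ in $\pi$ and $h_i=\sum_{p:\pi(p)=i}\phi(p)$. Call $\pi$ *mirrored* if $\pi(p)=\pi(k-p+1)$ for all $p$. Let $s^*$ be the largest integer $p$ with $1\le p<(k+1)/2$ and $\lambda_1\phi(p)^2>\lambda_0$ if $\lambda_1\phi(1)^2>\lambda_0$, and $s^*=0$ otherwise. For $0\le q\le k/2$ an order *of form* $\pi_q$ is one of the form $(i_1,\dots,i_q,i_{q+1},\dots,i_{k-q},i_q,\dots,i_1)$ with $i_1,\dots,i_{k-q}$ distinct. Write $k=mv+t$ with $0\le t<v$. Say that $\pi$ has *balanced layout* if $n_i=m+1$ for $i\le t$ and $n_i=m$ for $i>t$; the treatments with $n_i$ even occupy exactly the positions $1,\dots,e$ and $k-e+1,\dots,k$, where $e=(m+1)t/2$ for $m$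 odd and $e=m(v-t)/2$ for $m$ even; and $\pi(p)=\pi(k-p+1)$ at these positions. Let $\pi^*$ be an order of the following kind. * If $k<2v$ and $k\le v+s^*$: form $\pi_{s^*}$. If $k<2v$ and $k>v+s^*$: form $\pi_{k-v}$. * If $k\ge2v$ and $k$ is odd: balanced layout with $h_i=0$ for all $i$ with $n_i$ odd. * If $k\ge2v$, $k$ is even and $k/v$ is an even integer: mirrored with $n_i=m$ for all $i$. * If $k\ge2v$, $k$ is even and $k/v$ is not an even integer: when $\lambda_1\phi(k/2)^2>\lambda_0$, mirrored with all $n_i\in\{\xi,\xi+2\}$, where $\xi$ is the even one of $m-1,m$; when $\lambda_1\phi(k/2)^2\le\lambda_0$, balanced layout with $|h_i|=\phi(\tfrac{k+2}{2})$ for all $i$ with $n_i$ odd. **Theorem 3.6.** Let $k^*$ be the number of distinct treatments in $\pi^*$, and let $\tilde d_1^*$ be a $k^*\times b$ semibalanced array on the $v$ treatments; if $k^*\le2$, assume also that each row of $\tilde d_1^*$ contains every treatment equally often. Consider the $k\times b$ designs $$\tilde d^*=\Pi\begin{pmatrix}\tilde d_1^*\\ \tilde d_2^*\end{pmatrix},$$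 where each row of $\tilde d_2^*$ is identical to some row of $\tilde d_1^*$ and $\Pi$ is a permutation matrix of order $k$ such that, up to a relabelling of the treatments, $\tilde d^*(p,1)=\pi^*(p)$ for $p=1,\dots,k$. Such designs exist, and every such $\tilde d^*$ is maximin universally optimal. -/

import Mathlib

open scoped Matrix

/-- The linear orthonormal polynomial `φ(p)` on `{1, …, k}`; the argument `p` is the 1-based position. -/
noncomputable def trendPoly (k p : ℕ) : ℝ :=
  √(3 / ((k : ℝ) * ((k : ℝ) ^ 2 - 1))) * (2 * (p : ℝ) - (k : ℝ) - 1)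

/-- The vector `φ = (φ(1), …, φ(k))'`.  The element `p : Fin k` stands for position `p + 1`. -/
noncomputable def trendVec (k : ℕ) : Fin k → ℝ := fun p => trendPoly k ((p : ℕ) + 1)

/-- A design for `v` treatments in `b` blocks of `k` ordered units, seen as a `k × b` array of
treatments: `d p j` is the treatment on unit `p` of block `j`. -/
abbrev BlockDesign (v k b : ℕ) := Matrix (Fin k) (Fin b) (Fin v)

/-- The `k × v` unit-treatment incidence matrix `X_{dj}` of block `j`. -/
def unitIncidence {v k b : ℕ} (d : BlockDesign v k b) (j : Fin b) : Matrix (Fin k) (Fin v) ℝ :=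
  Matrix.of fun p i => if d p j = i then 1 else 0

/-- The vector `r_d` of treatment replications. -/
def replicationVec {v k b : ℕ} (d : BlockDesign v k b) : Fin v → ℝ :=
  fun i => ((Finset.univ.filter fun x : Fin k × Fin b => d x.1 x.2 = i).card : ℝ)

/-- The `v × k` treatment-unit (row) incidence matrix `M_d`. -/
def rowIncidence {v k b : ℕ} (d : BlockDesign v k b) : Matrix (Fin v) (Fin k) ℝ :=
  Matrix.of fun i p => ((Finset.univ.filter fun j : Fin b => d p j = i).card : ℝ)

/-- `W = I_k - λ₀ 1 1' - λ₁ φ φ'`. -/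
noncomputable def weightMatrix (k : ℕ) (lam₀ lam₁ : ℝ) : Matrix (Fin k) (Fin k) ℝ :=
  1 - lam₀ • (Matrix.of fun _ _ => (1 : ℝ)) - lam₁ • Matrix.vecMulVec (trendVec k) (trendVec k)

/-- The minimal information matrix `C_d^L` for the error variance `s2 = σ²_{0ε}`. -/
noncomputable def minimalInfo {v k b : ℕ} (s2 lam₀ lam₁ : ℝ) (d : BlockDesign v k b) :
    Matrix (Fin v) (Fin v) ℝ :=
  s2⁻¹ •
    ((∑ j : Fin b, (unitIncidence d j)ᵀ * weightMatrix k lam₀ lam₁ * unitIncidence d j)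
      - ((1 - (k : ℝ) * lam₀) / ((b : ℝ) * (k : ℝ))) •
          Matrix.vecMulVec (replicationVec d) (replicationVec d)
      - ((1 - lam₁) / (b : ℝ)) •
          (rowIncidence d * Matrix.vecMulVec (trendVec k) (trendVec k) * (rowIncidence d)ᵀ))

/-- Complete symmetry: all diagonal entries agree and all off-diagonal entries agree. -/
def IsCompletelySymmetric {v : ℕ} (C : Matrix (Fin v) (Fin v) ℝ) : Prop :=
  ∃ x y : ℝ, C = x • (1 : Matrix (Fin v) (Fin v) ℝ) + y • (Matrix.of fun _ _ => (1 : ℝ))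

/-- Maximin universal optimality: `C_d^L` is completely symmetric and has the largest trace among
all designs with the same `v`, `k`, `b`. -/
def IsMaximinUniversallyOptimal {v k b : ℕ} (s2 lam₀ lam₁ : ℝ) (d : BlockDesign v k b) : Prop :=
  IsCompletelySymmetric (minimalInfo s2 lam₀ lam₁ d) ∧
    ∀ d' : BlockDesign v k b,
      (minimalInfo s2 lam₀ lam₁ d').trace ≤ (minimalInfo s2 lam₀ lam₁ d).trace

/-- Semibalanced array (orthogonal array of type II and strength 2): every column has distinct
symbols, and any two rows contain every (unordered) pair of distinct symbols equally often. -/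
def IsSemibalanced {v t b : ℕ} (A : Matrix (Fin t) (Fin b) (Fin v)) : Prop :=
  (∀ j, Function.Injective fun r => A r j) ∧
    ∀ r s, r ≠ s → ∃ μ : ℕ, ∀ x y : Fin v, x ≠ y →
      (Finset.univ.filter fun j : Fin b =>
        (A r j = x ∧ A s j = y) ∨ (A r j = y ∧ A s j = x)).card = μ

/-- Every row contains each symbol equally often. -/
def HasUniformRows {v t b : ℕ} (A : Matrix (Fin t) (Fin b) (Fin v)) : Prop :=
  ∀ r, ∃ μ : ℕ, ∀ x : Fin v, (Finset.univ.filter fun j : Fin b => A r j = x).card = μ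

/-- The replication `n_i` of treatment `i` in the order `π`. -/
def replication {v k : ℕ} (π : Fin k → Fin v) (i : Fin v) : ℕ :=
  (Finset.univ.filter fun p : Fin k => π p = i).card

/-- `h_i = ∑ φ(p)`, the sum over the positions `p` of treatment `i` in the order `π`. -/
noncomputable def trendSum {v k : ℕ} (π : Fin k → Fin v) (i : Fin v) : ℝ :=
  ∑ p : Fin k, if π p = i then trendVec k p else 0

/-- The number of distinct treatments in the order `π`. -/
def numTreatments {v k : ℕ} (π : Fin k → Fin v) : ℕ := (Finset.univ.image π).card

open Classical in
/-- `s* = max {p : 1 ≤ p < (k + 1) / 2, λ₁ φ(p)² > λ₀}` if `λ₁ φ(1)² > λ₀`, and `0` otherwise. -/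
noncomputable def sStar (k : ℕ) (lam₀ lam₁ : ℝ) : ℕ :=
  if lam₀ < lam₁ * trendPoly k 1 ^ 2 then
    ((Finset.range (k + 1)).filter fun p =>
      1 ≤ p ∧ 2 * p < k + 1 ∧ lam₀ < lam₁ * trendPoly k p ^ 2).sup id
  else 0

/-- Orders `(i₁, …, i_q, i_{q+1}, …, i_{k-q}, i_q, …, i₁)` with `i₁, …, i_{k-q}` distinct. -/
def IsEndMirrored {v k : ℕ} (q : ℕ) (π : Fin k → Fin v) : Prop :=
  2 * q ≤ k ∧ Set.InjOn π {p | (p : ℕ) < k - q} ∧ ∀ p : Fin k, (p : ℕ) < q → π p.rev = π p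

/-- The whole order reads the same backwards: `π(p) = π(k - p + 1)`. -/
def IsMirrored {v k : ℕ} (π : Fin k → Fin v) : Prop := ∀ p : Fin k, π p.rev = π p

/-- With `k = m v + t`, the replications are `m + 1` for the first `t` treatments and `m` for the
others; the treatments with even replication, `2 e` units in total, occupy exactly the positions
`1, …, e` and `k - e + 1, …, k`, where they are arranged so that `π(p) = π(k - p + 1)`. -/
def HasBalancedOuterLayout {v k : ℕ} (π : Fin k → Fin v) : Prop :=
  let m := k / v
  let t := k % v
  let e := if Odd m then (m + 1) * t / 2 else m * (v - t) / 2
  (∀ i : Fin v, replication π i = if (i : ℕ) < t then m + 1 else m) ∧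
    ∀ p : Fin k,
      (Even (replication π (π p)) ↔ (p : ℕ) + 1 ≤ e ∨ k - e + 1 ≤ (p : ℕ) + 1) ∧
      (Even (replication π (π p)) → π p.rev = π p)

/-- Trend-free orders of the first kind (`k` odd). -/
def IsTrendFreeA {v k : ℕ} (π : Fin k → Fin v) : Prop :=
  HasBalancedOuterLayout π ∧ ∀ i : Fin v, Odd (replication π i) → trendSum π i = 0

/-- Trend-free orders of the second kind (`k` even, `k / v` an even integer). -/
def IsTrendFreeB {v k : ℕ} (π : Fin k → Fin v) : Prop :=
  (∀ i : Fin v, replication π i = k / v) ∧ IsMirrored π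

/-- Trend-free orders of the third kind (`k` even, `k / v` not an even integer): the replications
are `ξ` or `ξ + 2`, with `ξ` the even one of `m - 1` and `m`, where `m` is the integer part of
`k / v`. -/
def IsTrendFreeC {v k : ℕ} (π : Fin k → Fin v) : Prop :=
  let m := k / v
  let ξ := if Even m then m else m - 1
  (∀ i : Fin v, replication π i = ξ ∨ replication π i = ξ + 2) ∧ IsMirrored π

/-- Nearly trend-free orders (`k` even, `k / v` not an even integer). -/
def IsNearlyTrendFree {v k : ℕ} (π : Fin k → Fin v) : Prop :=
  HasBalancedOuterLayout π ∧
    ∀ i : Fin v, Odd (replication π i) → |trendSum π i| = trendPoly k ((k + 2) / 2)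

/-- The orders that are prescribed for given `v`, `k`, `λ₀`, `λ₁`.  For `v ≥ 1`, the condition
`2 * v ∣ k` says that `k / v` is an even integer. -/
def IsPrescribedOrder {v k : ℕ} (lam₀ lam₁ : ℝ) (π : Fin k → Fin v) : Prop :=
  (k < 2 * v ∧
    ((k ≤ v + sStar k lam₀ lam₁ ∧ IsEndMirrored (sStar k lam₀ lam₁) π) ∨
      (v + sStar k lam₀ lam₁ < k ∧ IsEndMirrored (k - v) π))) ∨
  (2 * v ≤ k ∧
    ((Odd k ∧ IsTrendFreeA π) ∨
      (Even k ∧ 2 * v ∣ k ∧ IsTrendFreeB π) ∨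
      (Even k ∧ ¬ 2 * v ∣ k ∧
        ((lam₀ < lam₁ * trendPoly k (k / 2) ^ 2 ∧ IsTrendFreeC π) ∨
          (lam₁ * trendPoly k (k / 2) ^ 2 ≤ lam₀ ∧ IsNearlyTrendFree π)))))

/-- `d` arises from the array `A` by adjoining rows `d₂`, each a copy of a row of `A`, and then
permuting the `k` rows (the bijection `e`), in such a way that, up to a relabelling `ρ` of the
treatments, the first block of `d` is the order `π`. -/
def IsDesignFrom {v k b : ℕ} (hb : 0 < b) (π : Fin k → Fin v)
    (A : Matrix (Fin (numTreatments π)) (Fin b) (Fin v)) (d : BlockDesign v k b) : Prop :=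
  ∃ (d₂ : Matrix (Fin (k - numTreatments π)) (Fin b) (Fin v))
    (e : Fin (numTreatments π) ⊕ Fin (k - numTreatments π) ≃ Fin k)
    (ρ : Equiv.Perm (Fin v)),
    (∀ s, ∃ r, d₂ s = A r) ∧ d.submatrix e id = Matrix.fromRows A d₂ ∧
      ∀ p : Fin k, d p ⟨0, hb⟩ = ρ (π p)

/-!
Up to the factor `s2⁻¹`, the trace of the information matrix of a design is a sum over the blocks,
minus a nonnegative multiple of `∑ᵢ rᵢ²`, minus a nonnegative multiple of `‖M φ‖²`
(`trace_minimalInfo`).  A block with treatment order `σ` contributes `k - orderCost σ`, where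
`orderCost σ = ∑ᵢ (λ₀ nᵢ² + λ₁ hᵢ²)`.  The trace is therefore largest when the replications agree,
`M φ = 0`, and every block has an order of least cost (`trace_minimalInfo_le`).

In a semibalanced array with uniform rows every treatment occurs equally often in each row, which
settles the first two conditions because `∑ₚ φ(p) = 0`.  Uniformity is automatic for three or more
rows (`IsSemibalanced.hasUniformRows`).  Every row of the design is a row of the array, and the
columns of the array have distinct symbols, so two rows agree in one block if and only if they
agree in all: each block is a relabelling of `π`, and `orderCost` is invariant under relabelling
(`orderCost_congr`).  Complete symmetry holds because the weight matrix is symmetric, so that only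
the frequencies of unordered pairs of treatments matter (`isCompletelySymmetric_minimalInfo`).

That `π` has least cost (`IsPrescribedOrder.orderCost_le`) is a duality argument in each case: a
lower bound for the cost of a single treatment whose total over the treatments is the same for all
orders, and which every treatment of `π` attains.  For `k ≥ 2 v` the bound is affine in the
replication `n`, namely a chord of the convex function `n ↦ λ₀ n²` corrected by a penalty for odd
`n`: when `k` is even, the sum of an odd number of values of `φ` is at least `|φ(k/2)|` in absolute
value (`trendPoly_sq_le_trendSum_sq`).  For `k < 2 v` the bound is a sum of charges to the
positions minus a multiplier `μ` for the number of treatments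
(`orderCost_le_of_isEndMirrored`).
-/

/-! ### The trend vector -/

theorem trendVec_rev {k : ℕ} (p : Fin k) : trendVec k p.rev = -trendVec k p := by
  have h : ((p.rev : ℕ) : ℝ) + (p : ℕ) + 1 = k := by
    have := p.isLt
    have h' : (p.rev : ℕ) + p + 1 = k := by rw [Fin.val_rev]; omega
    exact_mod_cast h'
  simp only [trendVec, trendPoly]
  push_cast
  rw [← mul_neg]
  congr 1
  linear_combination 2 * h

theorem sum_trendVec (k : ℕ) : ∑ p, trendVec k p = 0 := by
  have h : ∑ p, trendVec k p = ∑ p, -trendVec k p := by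
    rw [← Equiv.sum_comp Fin.revPerm (trendVec k)]
    exact Finset.sum_congr rfl fun p _ => by simp [trendVec_rev]
  rw [Finset.sum_neg_distrib] at h
  linarith

/-- Up to the middle of the block the trend decreases in absolute value. -/
theorem trendPoly_sq_le {k p q : ℕ} (hpq : p ≤ q) (hq : 2 * q ≤ k + 1) :
    trendPoly k q ^ 2 ≤ trendPoly k p ^ 2 := by
  have h1 : (p : ℝ) ≤ q := by exact_mod_cast hpq
  have h2 : 2 * (q : ℝ) ≤ k + 1 := by exact_mod_cast hq
  simp only [trendPoly, mul_pow]
  refine mul_le_mul_of_nonneg_left ?_ (sq_nonneg _)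
  nlinarith

theorem trendPoly_rev {k p : ℕ} (hp : p ≤ k + 1) :
    trendPoly k (k + 1 - p) = -trendPoly k p := by
  simp only [trendPoly]
  push_cast [Nat.cast_sub hp]
  ring

/-! ### The cost of an order -/

/-- The part of the trace of the information matrix that a block with treatment order `π` loses,
`∑ᵢ (λ₀ nᵢ² + λ₁ hᵢ²)`. -/
noncomputable def orderCost {v k : ℕ} (lam₀ lam₁ : ℝ) (π : Fin k → Fin v) : ℝ :=
  ∑ i, (lam₀ * (replication π i : ℝ) ^ 2 + lam₁ * trendSum π i ^ 2)

section OrderCost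

variable {v k : ℕ}

theorem trendSum_eq_sum_filter (π : Fin k → Fin v) (i : Fin v) :
    trendSum π i = ∑ p with π p = i, trendVec k p := by
  rw [trendSum, Finset.sum_filter]

theorem replication_eq_sum (π : Fin k → Fin v) (i : Fin v) :
    (replication π i : ℝ) = ∑ p : Fin k, if π p = i then (1 : ℝ) else 0 := by
  simp [replication]

theorem sum_replication (π : Fin k → Fin v) : ∑ i, replication π i = k := by
  have := Finset.card_eq_sum_card_fiberwise (f := π) (s := Finset.univ) (t := Finset.univ)
    (by simp)
  simpa [replication] using this.symm

theorem sum_replication_cast (π : Fin k → Fin v) : ∑ i, (replication π i : ℝ) = k := by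
  exact_mod_cast sum_replication π

/-- The cost of an order depends only on which positions carry the same treatment. -/
theorem orderCost_congr {lam₀ lam₁ : ℝ} {π π' : Fin k → Fin v}
    (h : ∀ p q, π p = π q ↔ π' p = π' q) : orderCost lam₀ lam₁ π = orderCost lam₀ lam₁ π' := by
  have key : ∀ σ : Fin k → Fin v, orderCost lam₀ lam₁ σ = ∑ p,
      (lam₀ * (replication σ (σ p) : ℝ) + lam₁ * (trendVec k p * trendSum σ (σ p))) := by
    intro σ
    rw [orderCost, ← Finset.sum_fiberwise Finset.univ σ]
    refine Finset.sum_congr rfl fun i _ => ?_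
    have : ∀ p ∈ Finset.univ.filter (fun p => σ p = i),
        lam₀ * (replication σ (σ p) : ℝ) + lam₁ * (trendVec k p * trendSum σ (σ p)) =
        lam₀ * (replication σ i : ℝ) + lam₁ * trendSum σ i * trendVec k p := by
      intro p hp
      rw [(Finset.mem_filter.1 hp).2]
      ring
    rw [Finset.sum_congr rfl this, Finset.sum_add_distrib, ← Finset.mul_sum, ← Finset.mul_sum,
      ← trendSum_eq_sum_filter, Finset.sum_const, nsmul_eq_mul]
    simp only [replication]
    ring
  rw [key, key]
  refine Finset.sum_congr rfl fun p _ => ?_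
  have h1 : replication π (π p) = replication π' (π' p) := by
    simp only [replication, h]
  have h2 : trendSum π (π p) = trendSum π' (π' p) := by
    simp only [trendSum, h]
  rw [h1, h2]

theorem trendSum_eq_zero_of_mirrored {π : Fin k → Fin v} {i : Fin v}
    (h : ∀ p, π p = i → π p.rev = i) : trendSum π i = 0 := by
  have h' : ∀ p : Fin k, π p.rev = i ↔ π p = i :=
    fun p => ⟨fun hp => by simpa using h _ hp, h p⟩
  have e : trendSum π i = -trendSum π i := by
    conv_lhs => rw [trendSum, ← Equiv.sum_comp Fin.revPerm]
    rw [trendSum, ← Finset.sum_neg_distrib]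
    refine Finset.sum_congr rfl fun p _ => ?_
    simp only [Fin.revPerm_apply, h', trendVec_rev]
    split_ifs <;> simp
  linarith

/-- For `k` even the values of the trend are odd multiples of `φ(k/2 + 1)`, hence so is the sum
of an odd number of them. -/
theorem trendPoly_sq_le_trendSum_sq (hk : Even k) {π : Fin k → Fin v} {i : Fin v}
    (h : Odd (replication π i)) : trendPoly k (k / 2) ^ 2 ≤ trendSum π i ^ 2 := by
  set c := √(3 / ((k : ℝ) * ((k : ℝ) ^ 2 - 1))) with hc
  obtain ⟨l, rfl⟩ := hk
  set N : ℤ := ∑ p : Fin (l + l) with π p = i, (2 * ((p : ℕ) - (l : ℤ)) + 1) with hN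
  have hodd : Odd N := by
    have : N = 2 * (∑ p : Fin (l + l) with π p = i, ((p : ℕ) - (l : ℤ))) + replication π i := by
      rw [hN, Finset.sum_add_distrib, ← Finset.mul_sum]
      simp [replication]
    rw [this]
    exact (even_two_mul _).add_odd (by exact_mod_cast h)
  have hsum : trendSum π i = c * N := by
    rw [trendSum_eq_sum_filter, hN]
    push_cast
    rw [Finset.mul_sum]
    refine Finset.sum_congr rfl fun p _ => ?_
    simp only [trendVec, trendPoly]
    push_cast at hc ⊢
    rw [hc]
    ring
  have hmid : trendPoly (l + l) ((l + l) / 2) = -c := by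
    rw [show (l + l) / 2 = l by omega, trendPoly]
    push_cast at hc ⊢
    rw [hc]
    ring
  have hN1 : (1 : ℝ) ≤ (N : ℝ) ^ 2 := by
    have h0 : N ≠ 0 := fun h0 => by simp [h0] at hodd
    have : 0 < N ^ 2 := by positivity
    exact_mod_cast this
  rw [hsum, hmid, mul_pow, neg_sq]
  exact le_mul_of_one_le_right (sq_nonneg _) hN1

theorem trendPoly_succ_mid_sq (hk : Even k) :
    trendPoly k ((k + 2) / 2) ^ 2 = trendPoly k (k / 2) ^ 2 := by
  have := trendPoly_rev (k := k) (p := k / 2) (by omega)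
  rw [show (k + 2) / 2 = k + 1 - k / 2 by obtain ⟨l, rfl⟩ := hk; omega, this, neg_sq]

/-- Comparison of costs through weak duality: `x + y n` is a lower bound for the cost of a treatment
with replication `n` in any order, every treatment of `π` attains it, and its total over the
treatments does not depend on the order. -/
theorem orderCost_le_of_affine {lam₀ lam₁ x y : ℝ} {π : Fin k → Fin v}
    (hπ : ∀ i, lam₀ * (replication π i : ℝ) ^ 2 + lam₁ * trendSum π i ^ 2 =
      x + y * replication π i)
    (h : ∀ (σ : Fin k → Fin v) i, x + y * replication σ i ≤
      lam₀ * (replication σ i : ℝ) ^ 2 + lam₁ * trendSum σ i ^ 2) (σ : Fin k → Fin v) :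
    orderCost lam₀ lam₁ π ≤ orderCost lam₀ lam₁ σ := by
  calc orderCost lam₀ lam₁ π = ∑ i, (x + y * replication π i) :=
      Finset.sum_congr rfl fun i _ => hπ i
    _ = ∑ i, (x + y * replication σ i) := by
      simp only [Finset.sum_add_distrib, ← Finset.mul_sum, sum_replication_cast]
    _ ≤ _ := Finset.sum_le_sum fun i _ => h σ i

theorem HasBalancedOuterLayout.replication_eq {π : Fin k → Fin v} (h : HasBalancedOuterLayout π)
    (i : Fin v) : replication π i = k / v ∨ replication π i = k / v + 1 := by
  have := h.1 i
  split_ifs at this <;> simp [this]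

theorem HasBalancedOuterLayout.trendSum_eq_zero {π : Fin k → Fin v}
    (h : HasBalancedOuterLayout π) {i : Fin v} (hi : Even (replication π i)) :
    trendSum π i = 0 := by
  refine trendSum_eq_zero_of_mirrored fun p hp => ?_
  rw [← hp] at hi
  rw [← hp]
  exact (h.2 p).2 hi

/-- The chord of `n ↦ n²` through two consecutive integers. -/
theorem chord_le_sq (m n : ℕ) : (2 * (m : ℝ) + 1) * n - m * (m + 1) ≤ (n : ℝ) ^ 2 := by
  have h : (0 : ℤ) ≤ ((n : ℤ) - m) * ((n : ℤ) - m - 1) := by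
    rcases le_or_gt (n : ℤ) m with h | h
    · exact mul_nonneg_of_nonpos_of_nonpos (by omega) (by omega)
    · exact mul_nonneg (by omega) (by omega)
  have h' : (0 : ℝ) ≤ ((n : ℝ) - m) * ((n : ℝ) - m - 1) := by exact_mod_cast h
  linarith

theorem orderCost_le_of_trendSum_eq_zero {lam₀ lam₁ : ℝ} (hlam₀ : 0 ≤ lam₀) (hlam₁ : 0 ≤ lam₁)
    {m : ℕ} {π : Fin k → Fin v} (hn : ∀ i, replication π i = m ∨ replication π i = m + 1)
    (hh : ∀ i, trendSum π i = 0) (σ : Fin k → Fin v) :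
    orderCost lam₀ lam₁ π ≤ orderCost lam₀ lam₁ σ := by
  refine orderCost_le_of_affine (x := -(lam₀ * (m * (m + 1)))) (y := lam₀ * (2 * m + 1))
    (fun i => ?_) (fun σ i => ?_) σ
  · rw [hh i]
    rcases hn i with h | h <;> rw [h] <;> push_cast <;> ring
  · have h1 := mul_le_mul_of_nonneg_left (chord_le_sq m (replication σ i)) hlam₀
    have h2 := mul_nonneg hlam₁ (sq_nonneg (trendSum σ i))
    linarith

/-- When `λ₁ φ(k/2)² ≥ λ₀`, an odd replication costs at least as much as the chord through the
neighbouring even ones. -/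
theorem orderCost_le_of_isTrendFreeC {lam₀ lam₁ : ℝ} (hlam₀ : 0 ≤ lam₀) (hlam₁ : 0 ≤ lam₁)
    (hk : Even k) (hlam : lam₀ ≤ lam₁ * trendPoly k (k / 2) ^ 2) {ξ : ℕ} (hξ : Even ξ)
    {π : Fin k → Fin v} (hn : ∀ i, replication π i = ξ ∨ replication π i = ξ + 2)
    (hπ : IsMirrored π) (σ : Fin k → Fin v) :
    orderCost lam₀ lam₁ π ≤ orderCost lam₀ lam₁ σ := by
  refine orderCost_le_of_affine (x := -(lam₀ * (ξ * (ξ + 2)))) (y := lam₀ * (2 * ξ + 2))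
    (fun i => ?_) (fun σ i => ?_) σ
  · rw [trendSum_eq_zero_of_mirrored fun p hp => (hπ p).trans hp]
    rcases hn i with h | h <;> rw [h] <;> push_cast <;> ring
  · set n := replication σ i with hn
    rcases Nat.even_or_odd n with he | ho
    · have h : (0 : ℤ) ≤ ((n : ℤ) - ξ) * ((n : ℤ) - ξ - 2) := by
        obtain ⟨a, ha⟩ := he
        obtain ⟨a', ha'⟩ := hξ
        rcases le_or_gt (n : ℤ) ξ with h | h
        · exact mul_nonneg_of_nonpos_of_nonpos (by omega) (by omega)
        · exact mul_nonneg (by omega) (by omega)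
      have h' : (0 : ℝ) ≤ ((n : ℝ) - ξ) * ((n : ℝ) - ξ - 2) := by exact_mod_cast h
      have h1 := mul_nonneg hlam₀ h'
      have h2 := mul_nonneg hlam₁ (sq_nonneg (trendSum σ i))
      linarith
    · have h1 := mul_le_mul_of_nonneg_left (trendPoly_sq_le_trendSum_sq hk (hn ▸ ho)) hlam₁
      have h2 := mul_nonneg hlam₀ (sq_nonneg ((n : ℝ) - ξ - 1))
      linarith

/-- When `λ₁ φ(k/2)² ≤ λ₀`, the penalty for an odd replication does not outweigh the convexity of
`n ↦ λ₀ n²`, so the most equal replications remain the best ones. -/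
theorem orderCost_le_of_isNearlyTrendFree {lam₀ lam₁ : ℝ} (hlam₁ : 0 ≤ lam₁)
    (hk : Even k) (hlam : lam₁ * trendPoly k (k / 2) ^ 2 ≤ lam₀)
    {π : Fin k → Fin v} (hπ : IsNearlyTrendFree π) (σ : Fin k → Fin v) :
    orderCost lam₀ lam₁ π ≤ orderCost lam₀ lam₁ σ := by
  set m := k / v with hm
  set e := lam₁ * trendPoly k (k / 2) ^ 2 with he
  have he0 : 0 ≤ e := mul_nonneg hlam₁ (sq_nonneg _)
  -- the cost of a treatment of `π`, and a lower bound for it in an arbitrary order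
  have hcost : ∀ i, lam₁ * trendSum π i ^ 2 = if Odd (replication π i) then e else 0 := by
    intro i
    split_ifs with h
    · rw [← sq_abs, hπ.2 i h, trendPoly_succ_mid_sq hk]
    · rw [hπ.1.trendSum_eq_zero (Nat.not_odd_iff_even.1 h)]
      ring
  have hbound : ∀ (σ : Fin k → Fin v) i,
      (if Odd (replication σ i) then e else 0) ≤ lam₁ * trendSum σ i ^ 2 := by
    intro σ i
    split_ifs with h
    · exact mul_le_mul_of_nonneg_left (trendPoly_sq_le_trendSum_sq hk h) hlam₁
    · exact mul_nonneg hlam₁ (sq_nonneg _)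
  have hconv : ∀ n : ℕ, 0 ≤ (lam₀ - e) * (((n : ℝ) - m) * ((n : ℝ) - m - 1)) := by
    intro n
    have := chord_le_sq m n
    exact mul_nonneg (sub_nonneg.2 hlam) (by linarith)
  rcases Nat.even_or_odd m with hme | hmo
  · refine orderCost_le_of_affine (x := -(lam₀ * (m * (m + 1))) - e * m)
      (y := lam₀ * (2 * m + 1) + e) (fun i => ?_) (fun σ i => ?_) σ
    · rw [hcost]
      rcases hπ.1.replication_eq i with h | h <;> rw [← hm] at h <;> rw [h]
      · rw [if_neg (Nat.not_odd_iff_even.2 hme)]; ring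
      · rw [if_pos hme.add_one]; push_cast; ring
    · refine le_trans ?_ (add_le_add_right (hbound σ i) _)
      have h1 := hconv (replication σ i)
      generalize replication σ i = n at h1 ⊢
      split_ifs with h
      · nlinarith [mul_nonneg he0 (sq_nonneg ((n : ℝ) - m - 1))]
      · have h2 : (0 : ℤ) ≤ ((n : ℤ) - m) * ((n : ℤ) - m - 2) := by
          obtain ⟨a, ha⟩ := Nat.not_odd_iff_even.1 h
          obtain ⟨a', ha'⟩ := hme
          rcases le_or_gt (n : ℤ) m with h | h
          · exact mul_nonneg_of_nonpos_of_nonpos (by omega) (by omega)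
          · exact mul_nonneg (by omega) (by omega)
        have h3 : (0 : ℝ) ≤ ((n : ℝ) - m) * ((n : ℝ) - m - 2) := by exact_mod_cast h2
        nlinarith [mul_nonneg he0 h3]
  · refine orderCost_le_of_affine (x := -(lam₀ * (m * (m + 1))) + e * (m + 1))
      (y := lam₀ * (2 * m + 1) - e) (fun i => ?_) (fun σ i => ?_) σ
    · rw [hcost]
      rcases hπ.1.replication_eq i with h | h <;> rw [← hm] at h <;> rw [h]
      · rw [if_pos hmo]; ring
      · rw [if_neg (Nat.not_odd_iff_even.2 hmo.add_one)]; push_cast; ring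
    · refine le_trans ?_ (add_le_add_right (hbound σ i) _)
      have h1 := hconv (replication σ i)
      generalize replication σ i = n at h1 ⊢
      split_ifs with h
      · nlinarith [mul_nonneg he0 (sq_nonneg ((n : ℝ) - m))]
      · have h2 : (0 : ℤ) ≤ ((n : ℤ) - m - 1) * ((n : ℤ) - m + 1) := by
          obtain ⟨a, ha⟩ := Nat.not_odd_iff_even.1 h
          obtain ⟨a', ha'⟩ := hmo
          rcases le_or_gt (n : ℤ) m with h | h
          · exact mul_nonneg_of_nonpos_of_nonpos (by omega) (by omega)
          · exact mul_nonneg (by omega) (by omega)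
        have h3 : (0 : ℝ) ≤ ((n : ℝ) - m - 1) * ((n : ℝ) - m + 1) := by exact_mod_cast h2
        nlinarith [mul_nonneg he0 h3]

end OrderCost

/-! ### Orders with fewer than two units per treatment -/

section EndMirrored

variable {v k : ℕ}

theorem sStar_spec {lam₀ lam₁ : ℝ} (h : 0 < sStar k lam₀ lam₁) :
    2 * sStar k lam₀ lam₁ < k + 1 ∧ lam₀ < lam₁ * trendPoly k (sStar k lam₀ lam₁) ^ 2 := by
  classical
  rw [sStar] at h ⊢
  split_ifs at h ⊢ with h0
  · set S := (Finset.range (k + 1)).filter fun p =>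
      1 ≤ p ∧ 2 * p < k + 1 ∧ lam₀ < lam₁ * trendPoly k p ^ 2 with hS
    have hne : S.Nonempty := by
      by_contra hne
      rw [Finset.not_nonempty_iff_eq_empty] at hne
      simp [hne] at h
    obtain ⟨p, hp, hp'⟩ := Finset.exists_mem_eq_sup S hne id
    rw [hp']
    exact (Finset.mem_filter.1 hp).2.2
  · simp at h

theorem le_of_le_sStar {lam₀ lam₁ : ℝ} (hlam₁ : 0 ≤ lam₁) {p : ℕ} (h0 : 0 < p)
    (h : p ≤ sStar k lam₀ lam₁) : lam₀ ≤ lam₁ * trendPoly k p ^ 2 := by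
  obtain ⟨h1, h2⟩ := sStar_spec (h0.trans_le h)
  exact h2.le.trans (mul_le_mul_of_nonneg_left (trendPoly_sq_le h h1.le) hlam₁)

theorem le_of_sStar_lt {lam₀ lam₁ : ℝ} (hlam₀ : 0 ≤ lam₀) (hlam₁ : 0 ≤ lam₁) {p : ℕ}
    (h : sStar k lam₀ lam₁ < p) (hp : 2 * p ≤ k + 1) : lam₁ * trendPoly k p ^ 2 ≤ lam₀ := by
  classical
  rcases hp.eq_or_lt with hp | hp
  · have : 2 * (p : ℝ) = k + 1 := by exact_mod_cast hp
    have h0 : trendPoly k p = 0 := by rw [trendPoly, this]; ring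
    simpa [h0] using hlam₀
  · by_contra! hlt
    have h1 : lam₀ < lam₁ * trendPoly k 1 ^ 2 :=
      hlt.trans_le (mul_le_mul_of_nonneg_left (trendPoly_sq_le (by omega) hp.le) hlam₁)
    rw [sStar, if_pos h1] at h
    refine h.not_ge (Finset.le_sup (f := id) (Finset.mem_filter.2 ⟨?_, ?_, hp, hlt⟩))
    · rw [Finset.mem_range]; omega
    · omega

/-- In an order of form `π_q` the positions of a treatment form a mirrored pair among the `q`
outer pairs, or a single one of the remaining inner positions. -/
theorem IsEndMirrored.fiber_eq {q : ℕ} {π : Fin k → Fin v} (h : IsEndMirrored q π) (p : Fin k) :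
    ∃ r : Fin k, ((r : ℕ) < q ∧ r ≠ r.rev ∧
        Finset.univ.filter (fun x => π x = π p) = {r, r.rev}) ∨
      (q ≤ (r : ℕ) ∧ q ≤ (r.rev : ℕ) ∧ Finset.univ.filter (fun x => π x = π p) = {r}) := by
  obtain ⟨hq, hinj, hrev⟩ := h
  have hrev' : ∀ x : Fin k, k - q ≤ (x : ℕ) → (x.rev : ℕ) < q ∧ π x.rev = π x := by
    intro x hx
    have hlt : (x.rev : ℕ) < q := by rw [Fin.val_rev]; omega
    exact ⟨hlt, by simpa using (hrev _ hlt).symm⟩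
  obtain ⟨r, hr, hrp⟩ : ∃ r : Fin k, (r : ℕ) < k - q ∧ π r = π p := by
    rcases lt_or_ge (p : ℕ) (k - q) with hp | hp
    · exact ⟨p, hp, rfl⟩
    · exact ⟨p.rev, by have := (hrev' p hp).1; omega, (hrev' p hp).2⟩
  have hfib : ∀ x, π x = π p → x = r ∨ (x = r.rev ∧ (r : ℕ) < q) := by
    intro x hx
    rcases lt_or_ge (x : ℕ) (k - q) with hxk | hxk
    · exact Or.inl (hinj hxk hr (hx.trans hrp.symm))
    · obtain ⟨h1, h2⟩ := hrev' x hxk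
      have : x.rev = r := hinj (show (x.rev : ℕ) < k - q by omega) hr (by rw [h2, hx, hrp])
      exact Or.inr ⟨by rw [← this, Fin.rev_rev], by rw [← this]; exact h1⟩
  refine ⟨r, ?_⟩
  rcases lt_or_ge (r : ℕ) q with hrq | hrq
  · refine Or.inl ⟨hrq, fun he => ?_, ?_⟩
    · have := congrArg Fin.val he
      rw [Fin.val_rev] at this
      omega
    · ext x
      simp only [Finset.mem_filter, Finset.mem_univ, true_and, Finset.mem_insert,
        Finset.mem_singleton]
      refine ⟨fun hx => (hfib x hx).imp_right And.left, ?_⟩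
      rintro (rfl | rfl)
      · exact hrp
      · rw [hrev r hrq, hrp]
  · refine Or.inr ⟨hrq, by rw [Fin.val_rev]; omega, ?_⟩
    ext x
    simp only [Finset.mem_filter, Finset.mem_univ, true_and, Finset.mem_singleton]
    refine ⟨fun hx => (hfib x hx).resolve_right fun h => by omega, ?_⟩
    rintro rfl
    exact hrp

/-- Optimality of orders of form `π_q` by duality: the position `p` is charged
`min (μ + λ₀ + λ₁ φ(p)²) (μ / 2 + 2 λ₀)`, the first when it is cheaper to use `p` alone and the
second when it is cheaper to pair it, where `μ ≥ 0` is the multiplier of the constraint that at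
most `v` treatments are available.  No treatment costs less than its charges minus `μ`. -/
theorem orderCost_le_of_isEndMirrored {lam₀ lam₁ μ : ℝ} (hlam₁ : 0 ≤ lam₁)
    (hμ : 0 ≤ μ) (hμ' : μ ≤ 2 * lam₀) {q : ℕ} {π : Fin k → Fin v} (hπ : IsEndMirrored q π)
    (hout : ∀ p, 0 < p → p ≤ q → lam₀ - μ / 2 ≤ lam₁ * trendPoly k p ^ 2)
    (hin : ∀ p, q < p → 2 * p ≤ k + 1 → lam₁ * trendPoly k p ^ 2 ≤ lam₀ - μ / 2)
    (hslack : μ = 0 ∨ Function.Surjective π) (σ : Fin k → Fin v) :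
    orderCost lam₀ lam₁ π ≤ orderCost lam₀ lam₁ σ := by
  set w : Fin k → ℝ := fun p =>
    min (μ + lam₀ + lam₁ * trendVec k p ^ 2) (μ / 2 + 2 * lam₀) with hw
  have hsum : ∀ τ : Fin k → Fin v, ∑ i, ((∑ p with τ p = i, w p) - μ) = ∑ p, w p - v * μ := by
    intro τ
    rw [Finset.sum_sub_distrib, Finset.sum_fiberwise]
    simp
  have hupper : orderCost lam₀ lam₁ π ≤ ∑ p, w p - v * μ := by
    rw [← hsum π]
    refine Finset.sum_le_sum fun i _ => ?_
    by_cases hi : ∃ p, π p = i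
    · obtain ⟨p, rfl⟩ := hi
      rw [trendSum_eq_sum_filter, replication]
      obtain ⟨r, ⟨hrq, hne, hf⟩ | ⟨hrq, hrq', hf⟩⟩ := hπ.fiber_eq p <;> rw [hf]
      · rw [Finset.sum_pair hne, Finset.sum_pair hne, Finset.card_pair hne]
        have h1 := hout (r + 1) (by omega) (by omega)
        have h2 : w r = μ / 2 + 2 * lam₀ := min_eq_right (by rw [trendVec]; linarith)
        have h3 : w r.rev = w r := by simp only [hw, trendVec_rev, neg_sq]
        rw [h3, h2, trendVec_rev]
        push_cast
        linarith
      · rw [Finset.sum_singleton, Finset.sum_singleton, Finset.card_singleton]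
        have h1 : lam₁ * trendVec k r ^ 2 ≤ lam₀ - μ / 2 := by
          rcases le_or_gt (2 * ((r : ℕ) + 1)) (k + 1) with h | h
          · exact hin _ (by omega) h
          · rw [← neg_sq, ← trendVec_rev]
            exact hin _ (by omega) (by rw [Fin.val_rev]; omega)
        have h2 : w r = μ + lam₀ + lam₁ * trendVec k r ^ 2 := min_eq_left (by linarith)
        rw [h2]
        push_cast
        linarith
    · have hμ0 : μ = 0 := hslack.resolve_right fun h => hi (h i)
      have hf : Finset.univ.filter (fun x => π x = i) = ∅ := by
        simpa [Finset.filter_eq_empty_iff] using hi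
      rw [trendSum_eq_sum_filter, replication, hf]
      simp [hμ0]
  have hlower : ∑ p, w p - v * μ ≤ orderCost lam₀ lam₁ σ := by
    rw [← hsum σ]
    refine Finset.sum_le_sum fun i _ => ?_
    rw [trendSum_eq_sum_filter, replication]
    generalize Finset.univ.filter (fun x => σ x = i) = S
    have hsq : 0 ≤ lam₁ * (∑ p ∈ S, trendVec k p) ^ 2 := mul_nonneg hlam₁ (sq_nonneg _)
    rcases Nat.lt_or_ge S.card 2 with hS | hS
    · rcases Nat.lt_or_ge S.card 1 with hS' | hS'
      · rw [Finset.card_eq_zero.1 (by omega : S.card = 0)]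
        simpa using hμ
      · obtain ⟨p, rfl⟩ := Finset.card_eq_one.1 (by omega : S.card = 1)
        simp only [Finset.sum_singleton, Finset.card_singleton]
        have : w p ≤ μ + lam₀ + lam₁ * trendVec k p ^ 2 := min_le_left _ _
        push_cast
        linarith
    · have h1 : ∑ p ∈ S, w p ≤ S.card * (μ / 2 + 2 * lam₀) := by
        rw [← nsmul_eq_mul]
        exact Finset.sum_le_card_nsmul _ _ _ fun p _ => min_le_right _ _
      have hS2 : (2 : ℝ) ≤ S.card := by exact_mod_cast hS
      have h2 : 0 ≤ ((S.card : ℝ) - 2) * (S.card * lam₀ - μ / 2) := by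
        refine mul_nonneg (by linarith) ?_
        nlinarith
      linarith
  exact hupper.trans hlower

theorem IsEndMirrored.surjective {π : Fin k → Fin v} (hv : v ≤ k)
    (h : IsEndMirrored (k - v) π) : Function.Surjective π := by
  have hinj : Function.Injective fun x : Fin v => π (x.castLE hv) := by
    intro x y hxy
    have := h.2.1 (show ((x.castLE hv : Fin k) : ℕ) < k - (k - v) by simp; omega)
      (show ((y.castLE hv : Fin k) : ℕ) < k - (k - v) by simp; omega) hxy
    simpa using this
  intro i
  obtain ⟨x, hx⟩ := (Finite.injective_iff_surjective.1 hinj) i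
  exact ⟨_, hx⟩

end EndMirrored

/-! ### Optimality of the prescribed orders -/

theorem IsPrescribedOrder.orderCost_le {v k : ℕ} {lam₀ lam₁ : ℝ} (hlam₀ : 0 ≤ lam₀)
    (hlam₁ : 0 ≤ lam₁) {π : Fin k → Fin v} (hπ : IsPrescribedOrder lam₀ lam₁ π)
    (σ : Fin k → Fin v) : orderCost lam₀ lam₁ π ≤ orderCost lam₀ lam₁ σ := by
  rcases hπ with ⟨hk, ⟨-, h⟩ | ⟨hq, h⟩⟩ | ⟨hk, ⟨hodd, h⟩ | ⟨-, -, h⟩ | ⟨heven, -, h⟩⟩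
  · exact orderCost_le_of_isEndMirrored (μ := 0) hlam₁ le_rfl (by linarith) h
      (fun p h0 hp => by simpa using le_of_le_sStar hlam₁ h0 hp)
      (fun p hp h2 => by simpa using le_of_sStar_lt hlam₀ hlam₁ hp h2) (Or.inl rfl) σ
  · have h1 := le_of_sStar_lt hlam₀ hlam₁ (show sStar k lam₀ lam₁ < k - v by omega) (by omega)
    -- at this multiplier the pairing of position `k - v` is neither a gain nor a loss
    refine orderCost_le_of_isEndMirrored (μ := 2 * (lam₀ - lam₁ * trendPoly k (k - v) ^ 2)) hlam₁
      (by linarith) (by nlinarith [mul_nonneg hlam₁ (sq_nonneg (trendPoly k (k - v)))]) h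
      (fun p _ hp => ?_) (fun p hp h2 => ?_) (Or.inr (h.surjective (by omega))) σ
    · have := mul_le_mul_of_nonneg_left (trendPoly_sq_le (k := k) hp (by omega)) hlam₁
      linarith
    · have := mul_le_mul_of_nonneg_left (trendPoly_sq_le (k := k) hp.le h2) hlam₁
      linarith
  · refine orderCost_le_of_trendSum_eq_zero hlam₀ hlam₁ h.1.replication_eq (fun i => ?_) σ
    rcases Nat.even_or_odd (replication π i) with hi | hi
    · exact h.1.trendSum_eq_zero hi
    · exact h.2 i hi
  · exact orderCost_le_of_trendSum_eq_zero hlam₀ hlam₁ (fun i => Or.inl (h.1 i))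
      (fun i => trendSum_eq_zero_of_mirrored fun p hp => (h.2 p).trans hp) σ
  · rcases h with ⟨hlam, hn, hm⟩ | ⟨hlam, h⟩
    · refine orderCost_le_of_isTrendFreeC hlam₀ hlam₁ heven hlam.le ?_ hn hm σ
      split_ifs with hm
      · exact hm
      · exact Nat.Odd.sub_odd (Nat.not_even_iff_odd.1 hm) odd_one
    · exact orderCost_le_of_isNearlyTrendFree hlam₁ heven hlam h σ

/-! ### The trace of the information matrix -/

section Trace

variable {v k b : ℕ}

theorem sum_unitIncidence (d : BlockDesign v k b) (j : Fin b) (f : Fin k → ℝ) (i : Fin v) :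
    ∑ p, unitIncidence d j p i * f p = ∑ p, if d p j = i then f p else 0 := by
  simp [unitIncidence]

theorem trace_unitIncidence_weightMatrix (lam₀ lam₁ : ℝ) (d : BlockDesign v k b) (j : Fin b) :
    ((unitIncidence d j)ᵀ * weightMatrix k lam₀ lam₁ * unitIncidence d j).trace =
      k - orderCost lam₀ lam₁ fun p => d p j := by
  have hdiag : ∀ i, ((unitIncidence d j)ᵀ * weightMatrix k lam₀ lam₁ * unitIncidence d j) i i =
      replication (fun p => d p j) i - (lam₀ * (replication (fun p => d p j) i : ℝ) ^ 2 +
        lam₁ * trendSum (fun p => d p j) i ^ 2) := by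
    intro i
    set n : ℝ := (replication (fun p => d p j) i : ℝ) with hn
    set h := trendSum (fun p => d p j) i with hh
    have hn' : ∑ p, unitIncidence d j p i = n := by
      rw [hn, replication_eq_sum]; simp [unitIncidence]
    have hh' : ∑ p, unitIncidence d j p i * trendVec k p = h := by
      rw [sum_unitIncidence, hh, trendSum]
    have hrow : ∀ q, ((unitIncidence d j)ᵀ * weightMatrix k lam₀ lam₁) i q =
        unitIncidence d j q i - lam₀ * n - lam₁ * (h * trendVec k q) := by
      intro q
      rw [Matrix.mul_apply, ← hn', ← hh']
      simp only [weightMatrix, Matrix.sub_apply, Matrix.smul_apply, Matrix.of_apply,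
        Matrix.vecMulVec_apply, Matrix.transpose_apply, smul_eq_mul, mul_sub,
        Finset.sum_sub_distrib, Matrix.one_apply, Finset.mul_sum, Finset.sum_mul]
      congr 1
      · congr 1
        · simp
        · exact Finset.sum_congr rfl fun p _ => by ring
      · exact Finset.sum_congr rfl fun p _ => by ring
    have hsq : ∀ q, unitIncidence d j q i * unitIncidence d j q i = unitIncidence d j q i := by
      intro q; simp [unitIncidence]
    rw [Matrix.mul_apply]
    calc _ = ∑ q, (unitIncidence d j q i - lam₀ * n * unitIncidence d j q i -
          lam₁ * h * (unitIncidence d j q i * trendVec k q)) := by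
          refine Finset.sum_congr rfl fun q _ => ?_
          rw [hrow]
          linear_combination hsq q
      _ = _ := by
          rw [Finset.sum_sub_distrib, Finset.sum_sub_distrib, ← Finset.mul_sum, ← Finset.mul_sum,
            hn', hh']
          ring
  rw [Matrix.trace, orderCost, ← sum_replication_cast (fun p => d p j), ← Finset.sum_sub_distrib]
  exact Finset.sum_congr rfl fun i _ => hdiag i

theorem trace_minimalInfo (s2 lam₀ lam₁ : ℝ) (d : BlockDesign v k b) :
    (minimalInfo s2 lam₀ lam₁ d).trace =
      s2⁻¹ * ((∑ j, ((k : ℝ) - orderCost lam₀ lam₁ fun p => d p j)) -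
        (1 - (k : ℝ) * lam₀) / ((b : ℝ) * (k : ℝ)) * ∑ i, replicationVec d i ^ 2 -
        (1 - lam₁) / (b : ℝ) * ∑ i, (rowIncidence d *ᵥ trendVec k) i ^ 2) := by
  have h2 : (Matrix.vecMulVec (replicationVec d) (replicationVec d)).trace =
      ∑ i, replicationVec d i ^ 2 := by
    simp [Matrix.trace, Matrix.vecMulVec_apply, sq]
  have h3 : (rowIncidence d * Matrix.vecMulVec (trendVec k) (trendVec k) *
      (rowIncidence d)ᵀ).trace = ∑ i, (rowIncidence d *ᵥ trendVec k) i ^ 2 := by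
    rw [Matrix.mul_vecMulVec, Matrix.vecMulVec_mul, Matrix.vecMul_transpose]
    simp [Matrix.trace, Matrix.vecMulVec_apply, sq]
  rw [minimalInfo, Matrix.trace_smul, Matrix.trace_sub, Matrix.trace_sub, Matrix.trace_smul,
    Matrix.trace_smul, Matrix.trace_sum, h2, h3]
  simp only [trace_unitIncidence_weightMatrix, smul_eq_mul]

theorem replicationVec_eq_sum (d : BlockDesign v k b) (i : Fin v) :
    replicationVec d i = ∑ p, rowIncidence d i p := by
  simp only [replicationVec, rowIncidence, Matrix.of_apply, ← Nat.cast_sum]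
  congr 1
  rw [Finset.card_filter, Fintype.sum_prod_type]
  simp only [Finset.card_filter]

theorem sum_replicationVec (d : BlockDesign v k b) : ∑ i, replicationVec d i = k * b := by
  have := Finset.card_eq_sum_card_fiberwise (f := fun x : Fin k × Fin b => d x.1 x.2)
    (s := Finset.univ) (t := Finset.univ) (by simp)
  simp only [replicationVec, ← Nat.cast_sum]
  rw [← this]
  simp

/-- Equal replication of the treatments and absence of a treatment trend minimize the terms that
are subtracted from the blockwise part of the trace. -/
theorem trace_minimalInfo_le {s2 lam₀ lam₁ : ℝ} (hs2 : 0 ≤ s2) (hlam₀ : k * lam₀ ≤ 1)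
    (hlam₁ : lam₁ ≤ 1) {d d' : BlockDesign v k b}
    (hcost : ∀ j, orderCost lam₀ lam₁ (fun p => d p j) ≤ orderCost lam₀ lam₁ fun p => d' p j)
    {r : ℝ} (hr : ∀ i, replicationVec d i = r) (htrend : rowIncidence d *ᵥ trendVec k = 0) :
    (minimalInfo s2 lam₀ lam₁ d').trace ≤ (minimalInfo s2 lam₀ lam₁ d).trace := by
  rw [trace_minimalInfo, trace_minimalInfo, htrend]
  refine mul_le_mul_of_nonneg_left ?_ (inv_nonneg.2 hs2)
  have hrep : ∑ i, replicationVec d i ^ 2 ≤ ∑ i, replicationVec d' i ^ 2 := by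
    have h : ∑ i, (replicationVec d i ^ 2 + 2 * r * (replicationVec d' i - replicationVec d i)) ≤
        ∑ i, replicationVec d' i ^ 2 := by
      refine Finset.sum_le_sum fun i _ => ?_
      rw [hr i]
      nlinarith [sq_nonneg (replicationVec d' i - r)]
    rwa [Finset.sum_add_distrib, ← Finset.mul_sum, Finset.sum_sub_distrib, sum_replicationVec,
      sum_replicationVec, sub_self, mul_zero, add_zero] at h
  have htrend' : 0 ≤ ∑ i, (rowIncidence d' *ᵥ trendVec k) i ^ 2 :=
    Finset.sum_nonneg fun i _ => sq_nonneg _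
  have h1 : ∑ j, ((k : ℝ) - orderCost lam₀ lam₁ fun p => d' p j) ≤
      ∑ j, ((k : ℝ) - orderCost lam₀ lam₁ fun p => d p j) :=
    Finset.sum_le_sum fun j _ => sub_le_sub_left (hcost j) _
  have h2 := mul_le_mul_of_nonneg_left hrep
    (show 0 ≤ (1 - (k : ℝ) * lam₀) / ((b : ℝ) * (k : ℝ)) from
      div_nonneg (by linarith) (by positivity))
  have h3 := mul_nonneg (show 0 ≤ (1 - lam₁) / (b : ℝ) from
    div_nonneg (by linarith) (by positivity)) htrend'
  simp only [Pi.zero_apply, ne_eq, OfNat.ofNat_ne_zero, not_false_eq_true, zero_pow,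
    Finset.sum_const_zero, mul_zero, sub_zero]
  linarith

end Trace

/-! ### Semibalanced arrays -/

section Semibalanced

variable {v t b : ℕ} {A : Matrix (Fin t) (Fin b) (Fin v)}

/-- In two rows `r ≠ s` the symbol `x` occurs `(v - 1) μ` times in total.  Three such equations
determine the frequency of `x` in a row, so it does not depend on `x`. -/
theorem IsSemibalanced.hasUniformRows (hA : IsSemibalanced A) (ht : 3 ≤ t) :
    HasUniformRows A := by
  set c : Fin t → Fin v → ℕ := fun r x => (Finset.univ.filter fun j => A r j = x).card with hc
  have hpair : ∀ r s, r ≠ s → ∀ x y, c r x + c s x = c r y + c s y := by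
    intro r s hrs
    obtain ⟨μ, hμ⟩ := hA.2 r s hrs
    have key : ∀ x, c r x + c s x = (v - 1) * μ := by
      intro x
      have hdisj : Disjoint (Finset.univ.filter fun j => A r j = x)
          (Finset.univ.filter fun j => A s j = x) := by
        refine Finset.disjoint_filter.2 fun j _ h1 h2 => hrs (hA.1 j ?_)
        exact h1.trans h2.symm
      rw [hc]
      dsimp only
      rw [← Finset.card_union_of_disjoint hdisj]
      -- the columns that contain `x` in one of the two rows, sorted by the other symbol `y`
      rw [Finset.card_eq_sum_card_fiberwise (t := Finset.univ.erase x)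
        (f := fun j => if A r j = x then A s j else A r j)]
      · rw [Finset.sum_congr rfl (g := fun _ => μ)]
        · simp
        · intro y hy
          have hy' : x ≠ y := (Finset.ne_of_mem_erase hy).symm
          rw [← hμ x y hy']
          congr 1
          ext j
          have hne : A r j ≠ A s j := fun h => hrs (hA.1 j h)
          simp only [Finset.mem_filter, Finset.mem_union, Finset.mem_univ, true_and]
          split_ifs with h
          · subst h
            simp [hy']
          · simp only [h, false_or, false_and]
            tauto
      · intro j hj
        have hne : A r j ≠ A s j := fun h => hrs (hA.1 j h)
        simp only [Finset.coe_union, Finset.coe_filter, Finset.mem_univ, true_and, Set.mem_union,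
          Set.mem_ofPred_eq] at hj
        simp only [Finset.coe_erase, Finset.coe_univ, Set.mem_sdiff, Set.mem_univ,
          Set.mem_singleton_iff, true_and]
        split_ifs with h
        · exact fun h' => hne (h.trans h'.symm)
        · exact h
    intro x y
    rw [key, key]
  intro r
  obtain ⟨s, hs⟩ : ∃ s : Fin t, s ≠ r :=
    Fintype.exists_ne_of_one_lt_card (by simp; omega) r
  obtain ⟨u, hu⟩ : ∃ u : Fin t, u ∉ ({r, s} : Finset (Fin t)) := by
    by_contra! h
    have h1 : Finset.univ ⊆ ({r, s} : Finset (Fin t)) := fun u _ => h u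
    have h2 := (Finset.card_le_card h1).trans Finset.card_le_two
    rw [Finset.card_fin] at h2
    omega
  simp only [Finset.mem_insert, Finset.mem_singleton, not_or] at hu
  have hconst : ∀ x y, c r x = c r y := by
    intro x y
    have h1 := hpair r s hs.symm x y
    have h2 := hpair r u (Ne.symm hu.1) x y
    have h3 := hpair s u (Ne.symm hu.2) x y
    omega
  rcases isEmpty_or_nonempty (Fin v) with h | ⟨⟨x⟩⟩
  · exact ⟨0, fun x => h.elim x⟩
  · exact ⟨c r x, fun y => hconst y x⟩

end Semibalanced

/-! ### Designs built from a semibalanced array -/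

section Design

variable {v k t b : ℕ} {A : Matrix (Fin t) (Fin b) (Fin v)} {d : BlockDesign v k b}
  {g : Fin k → Fin t}

theorem rowIncidence_const (hA : HasUniformRows A) (hd : ∀ p j, d p j = A (g p) j) (p : Fin k) :
    ∃ μ : ℝ, ∀ x, rowIncidence d x p = μ := by
  obtain ⟨μ, hμ⟩ := hA (g p)
  refine ⟨μ, fun x => ?_⟩
  simp only [rowIncidence, Matrix.of_apply, hd, hμ]

theorem rowIncidence_eq (hA : HasUniformRows A) (hd : ∀ p j, d p j = A (g p) j) (x : Fin v)
    (p : Fin k) : rowIncidence d x p = b / v := by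
  obtain ⟨μ, hμ⟩ := rowIncidence_const hA hd p
  have h : ∑ y, rowIncidence d y p = b := by
    have := Finset.card_eq_sum_card_fiberwise (f := d p) (s := Finset.univ) (t := Finset.univ)
      (by simp)
    simp only [rowIncidence, Matrix.of_apply, ← Nat.cast_sum]
    rw [← this]
    simp
  have hv : (v : ℝ) ≠ 0 := by
    have := x.pos
    positivity
  simp only [hμ, Finset.sum_const, Finset.card_univ, Fintype.card_fin, nsmul_eq_mul] at h
  rw [hμ, ← h]
  field_simp

theorem rowIncidence_mulVec_trendVec (hA : HasUniformRows A)
    (hd : ∀ p j, d p j = A (g p) j) : rowIncidence d *ᵥ trendVec k = 0 := by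
  ext x
  simp only [Matrix.mulVec, dotProduct, rowIncidence_eq hA hd, ← Finset.mul_sum, sum_trendVec,
    mul_zero, Pi.zero_apply]

theorem replicationVec_eq (hA : HasUniformRows A) (hd : ∀ p j, d p j = A (g p) j) (x : Fin v) :
    replicationVec d x = k * (b / v) := by
  simp [replicationVec_eq_sum, rowIncidence_eq hA hd]

theorem isCompletelySymmetric_of_forall {C : Matrix (Fin v) (Fin v) ℝ}
    (h1 : ∀ x y, C x x = C y y) {c : ℝ} (h2 : ∀ x y, x ≠ y → C x y = c) :
    IsCompletelySymmetric C := by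
  rcases isEmpty_or_nonempty (Fin v) with h | ⟨⟨z⟩⟩
  · exact ⟨0, 0, Matrix.ext fun x => h.elim x⟩
  · refine ⟨C z z - c, c, Matrix.ext fun x y => ?_⟩
    rcases eq_or_ne x y with rfl | hxy
    · simp [h1 x z]
    · simp [Matrix.one_apply_ne hxy, h2 x y hxy]

theorem weightMatrix_symm (lam₀ lam₁ : ℝ) (p q : Fin k) :
    weightMatrix k lam₀ lam₁ p q = weightMatrix k lam₀ lam₁ q p := by
  simp [weightMatrix, Matrix.vecMulVec_apply, Matrix.one_apply, eq_comm (a := p), mul_comm]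

theorem sum_unitIncidence_apply (d : BlockDesign v k b) (W : Matrix (Fin k) (Fin k) ℝ)
    (x y : Fin v) :
    (∑ j, (unitIncidence d j)ᵀ * W * unitIncidence d j) x y =
      ∑ p, ∑ q, W p q * (Finset.univ.filter fun j => d p j = x ∧ d q j = y).card := by
  simp only [Matrix.sum_apply, Matrix.mul_apply, Matrix.transpose_apply, Finset.sum_mul]
  rw [Finset.sum_comm]
  rw [Finset.sum_congr rfl fun q _ => Finset.sum_comm, Finset.sum_comm]
  refine Finset.sum_congr rfl fun p _ => Finset.sum_congr rfl fun q _ => ?_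
  rw [Finset.card_filter]
  push_cast
  rw [Finset.mul_sum]
  refine Finset.sum_congr rfl fun j _ => ?_
  simp only [unitIncidence, Matrix.of_apply]
  split_ifs <;> simp_all

/-- Two rows of the design are equal or a pair of rows of the semibalanced array, and the weights
are symmetric, so only the frequencies of unordered pairs of treatments enter. -/
theorem isCompletelySymmetric_minimalInfo (s2 lam₀ lam₁ : ℝ) (hA : IsSemibalanced A)
    (hA' : HasUniformRows A) (hd : ∀ p j, d p j = A (g p) j) :
    IsCompletelySymmetric (minimalInfo s2 lam₀ lam₁ d) := by
  set W := weightMatrix k lam₀ lam₁ with hW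
  have hpairs : ∀ p q : Fin k, ∃ μ : ℕ, ∀ x y : Fin v, x ≠ y →
      (Finset.univ.filter fun j => d p j = x ∧ d q j = y).card +
        (Finset.univ.filter fun j => d q j = x ∧ d p j = y).card = μ := by
    intro p q
    by_cases hpq : g p = g q
    · refine ⟨0, fun x y hxy => ?_⟩
      have hne : ∀ z w, (∀ j, d z j = d w j) →
          (Finset.univ.filter fun j => d z j = x ∧ d w j = y) = ∅ := fun z w h =>
        Finset.filter_eq_empty_iff.2 fun j _ hj => hxy (hj.1.symm.trans ((h j).trans hj.2))
      rw [hne p q fun j => by rw [hd, hd, hpq], hne q p fun j => by rw [hd, hd, hpq]]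
      simp
    · obtain ⟨μ, hμ⟩ := hA.2 _ _ hpq
      refine ⟨μ, fun x y hxy => ?_⟩
      rw [← hμ x y hxy, Finset.filter_or, Finset.card_union_of_disjoint]
      · simp only [hd, and_comm]
      · exact Finset.disjoint_filter.2 fun j _ h1 h2 => hxy (h1.1.symm.trans h2.1)
  choose μ hμ using hpairs
  have hoff : ∀ x y, x ≠ y → (∑ j, (unitIncidence d j)ᵀ * W * unitIncidence d j) x y =
      (∑ p, ∑ q, W p q * μ p q) / 2 := by
    intro x y hxy
    rw [sum_unitIncidence_apply, eq_div_iff two_ne_zero, mul_two]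
    conv_lhs => enter [2]; rw [Finset.sum_comm]
    simp only [← Finset.sum_add_distrib]
    refine Finset.sum_congr rfl fun p _ => Finset.sum_congr rfl fun q _ => ?_
    rw [← hμ p q x y hxy, hW, weightMatrix_symm _ _ q p]
    push_cast
    ring
  have hdiag : ∀ x y, (∑ j, (unitIncidence d j)ᵀ * W * unitIncidence d j) x x =
      (∑ j, (unitIncidence d j)ᵀ * W * unitIncidence d j) y y := by
    intro x y
    rw [sum_unitIncidence_apply, sum_unitIncidence_apply]
    refine Finset.sum_congr rfl fun p _ => Finset.sum_congr rfl fun q _ => ?_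
    congr 2
    by_cases hpq : g p = g q
    · obtain ⟨ν, hν⟩ := hA' (g q)
      simp only [hd, hpq, and_self, hν]
    · have hempty : ∀ z, (Finset.univ.filter fun j => d p j = z ∧ d q j = z) = ∅ := fun z =>
        Finset.filter_eq_empty_iff.2 fun j _ hj =>
          hpq (hA.1 j (by simpa [hd] using hj.1.trans hj.2.symm))
      rw [hempty, hempty]
  have htrend : rowIncidence d * Matrix.vecMulVec (trendVec k) (trendVec k) *
      (rowIncidence d)ᵀ = 0 := by
    rw [Matrix.mul_vecMulVec, rowIncidence_mulVec_trendVec hA' hd]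
    ext x y
    simp [Matrix.mul_apply]
  rw [minimalInfo, htrend]
  refine isCompletelySymmetric_of_forall (fun x y => ?_) (fun x y hxy => ?_)
    (c := s2⁻¹ * ((∑ p, ∑ q, W p q * μ p q) / 2 -
      (1 - (k : ℝ) * lam₀) / ((b : ℝ) * (k : ℝ)) * (k * (b / v) * (k * (b / v)))))
  · simp only [Matrix.smul_apply, Matrix.sub_apply, Matrix.vecMulVec_apply,
      replicationVec_eq hA' hd, ← hW, hdiag x y, Matrix.zero_apply]
  · simp only [Matrix.smul_apply, Matrix.sub_apply, Matrix.vecMulVec_apply,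
      replicationVec_eq hA' hd, ← hW, hoff x y hxy, Matrix.zero_apply, smul_eq_mul, mul_zero,
      sub_zero]

end Design

section DesignFrom

variable {v k b : ℕ} {π : Fin k → Fin v} {A : Matrix (Fin (numTreatments π)) (Fin b) (Fin v)}

/-- All blocks of a design built from `A` have, up to relabelling, the same order `π`. -/
theorem IsDesignFrom.exists_rows {hb : 0 < b} (hA : IsSemibalanced A) {d : BlockDesign v k b}
    (hd : IsDesignFrom hb π A d) : ∃ g : Fin k → Fin (numTreatments π),
      (∀ p j, d p j = A (g p) j) ∧ ∀ j p q, d p j = d q j ↔ π p = π q := by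
  obtain ⟨d₂, e, ρ, hd₂, hsub, hfirst⟩ := hd
  have hrow : ∀ p, ∃ r, ∀ j, d p j = A r j := by
    intro p
    have h : ∀ j, d p j = Matrix.fromRows A d₂ (e.symm p) j := fun j => by
      have := congrFun (congrFun hsub (e.symm p)) j
      simpa using this
    rcases hp : e.symm p with r | s
    · exact ⟨r, fun j => by rw [h, hp, Matrix.fromRows_apply_inl]⟩
    · obtain ⟨r, hr⟩ := hd₂ s
      exact ⟨r, fun j => by rw [h, hp, Matrix.fromRows_apply_inr, hr]⟩
  choose g hg using hrow
  have hker : ∀ j p q, d p j = d q j ↔ g p = g q := fun j p q => by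
    rw [hg, hg]
    exact (hA.1 j).eq_iff
  refine ⟨g, hg, fun j p q => ?_⟩
  rw [hker, ← hker ⟨0, hb⟩, hfirst, hfirst, ρ.injective.eq_iff]

theorem exists_isDesignFrom (hb : 0 < b) (hA : IsSemibalanced A) :
    ∃ d : BlockDesign v k b, IsDesignFrom hb π A d := by
  classical
  set S := Finset.univ.image π with hS
  have hmem : ∀ p, π p ∈ S := fun p => Finset.mem_image_of_mem π (Finset.mem_univ p)
  let f : S ≃ Fin (numTreatments π) := S.equivFinOfCardEq rfl
  have hrep : ∀ r, ∃ p, π p = f.symm r := fun r => by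
    obtain ⟨p, -, hp⟩ := Finset.mem_image.1 (f.symm r).2
    exact ⟨p, hp⟩
  choose rep hrep using hrep
  have hinj : Function.Injective rep := fun r s h =>
    f.symm.injective (Subtype.ext (by rw [← hrep, ← hrep, h]))
  have hcard : Fintype.card ↥(Set.range rep)ᶜ = k - numTreatments π := by
    rw [Fintype.card_compl_set, Set.card_range_of_injective hinj]
    simp
  let e : Fin (numTreatments π) ⊕ Fin (k - numTreatments π) ≃ Fin k :=
    (Equiv.sumCongr (Equiv.ofInjective rep hinj) (Fintype.equivFinOfCardEq hcard).symm).trans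
      (Equiv.Set.sumCompl (Set.range rep))
  let g : Fin k → Fin (numTreatments π) := fun p => f ⟨π p, hmem p⟩
  have hgrep : ∀ r, g (rep r) = r := fun r => by
    simp only [g, hrep, Subtype.coe_eta, Equiv.apply_symm_apply]
  -- the relabelling sends the treatment `i` of `π` to the first entry of the row chosen for it
  obtain ⟨ρ, hρ⟩ := Finset.exists_equiv_extend_of_card_eq (α := Fin v) (t := Finset.univ)
    (by simp) (s := S) (f := fun i => if h : i ∈ S then A (f ⟨i, h⟩) ⟨0, hb⟩ else i)
    (Finset.subset_univ _) (by
      intro i hi i' hi' h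
      rw [Finset.mem_coe] at hi hi'
      simp only [hi, hi', dif_pos] at h
      exact congrArg Subtype.val (f.injective (hA.1 _ h)))
  refine ⟨Matrix.of fun p j => A (g p) j, Matrix.of fun s j => A (g (e (Sum.inr s))) j, e,
    ρ.trans (Equiv.subtypeUnivEquiv Finset.mem_univ), fun s => ⟨_, rfl⟩, ?_, fun p => ?_⟩
  · ext x j
    rcases x with r | s
    · have : e (Sum.inl r) = rep r := rfl
      simp [this, hgrep]
    · simp
  · have := hρ (π p) (hmem p)
    simp only [hmem, dif_pos] at this
    simpa [g] using this.symm

end DesignFrom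

theorem theorem3p6 (v k b : ℕ) (hk : 2 ≤ k) (hb : 0 < b) (s2 lam₀ lam₁ : ℝ) (hs2 : 0 < s2)
    (hlam₀ : 0 ≤ lam₀) (hlam₀_le : lam₀ ≤ 1 / (k : ℝ)) (hlam₁ : 0 ≤ lam₁) (hlam₁_le : lam₁ ≤ 1)
    (π : Fin k → Fin v) (hπ : IsPrescribedOrder lam₀ lam₁ π)
    (A : Matrix (Fin (numTreatments π)) (Fin b) (Fin v)) (hA : IsSemibalanced A)
    (hA_uniform : numTreatments π ≤ 2 → HasUniformRows A) :
    (∃ d : BlockDesign v k b, IsDesignFrom hb π A d) ∧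
      ∀ d : BlockDesign v k b, IsDesignFrom hb π A d →
        IsMaximinUniversallyOptimal s2 lam₀ lam₁ d := by
  refine ⟨exists_isDesignFrom hb hA, fun d hd => ?_⟩
  have hA' : HasUniformRows A := by
    rcases le_or_gt (numTreatments π) 2 with h | h
    · exact hA_uniform h
    · exact hA.hasUniformRows h
  obtain ⟨g, hg, hker⟩ := hd.exists_rows hA
  refine ⟨isCompletelySymmetric_minimalInfo s2 lam₀ lam₁ hA hA' hg, fun d' => ?_⟩
  have hk0 : (0 : ℝ) < k := by positivity
  refine trace_minimalInfo_le hs2.le (by rwa [le_div_iff₀' hk0] at hlam₀_le) hlam₁_le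
    (fun j => ?_) (replicationVec_eq hA' hg) (rowIncidence_mulVec_trendVec hA' hg)
  rw [orderCost_congr (π := fun p => d p j) (π' := π) (hker j)]
  exact hπ.orderCost_le hlam₀ hlam₁ _
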